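/- Let $n\ge 1$ and let $\nu$ be a Borel probability measure (a prior) on $\mathbb R^n$. Call $\nu$ isotropic if it is invariant under all orthogonal transformations of $\mathbb R^n$. With $x\sim\nu$ and $x_1$ the first coordinate of $x$, let $$\kappa=\frac{\mathbb E[|x_1|]}{\sqrt{1+\mathbb E[|x_1|]^2}},\qquad \bar\gamma=\bar\gamma(\nu)=1+\frac1{1+\kappa^2},\qquad \upsilon_n=\frac32+\frac12\cdot\frac{1}{1+\dfrac{2n\,\Gamma(n/2)^2}{\pi\,\Gamma((n+1)/2)^2}} .$$ 1. If $\nu$ is isotropic with finite second moment and covariance matrix $I_n$, then $\bar\gamma(\nu)\ge\upsilon_n$, with equality if and only if $\nu$ is the uniform probability distribution on the sphere of radius $\sqrt n$ centered at the origin. 2. The sequence $(\upsilon_n)_{n\ge1}$ is strictly increasing, with limit $$\upsilon_\infty=\frac{2(3+\pi)}{4+\pi},$$ and $|\upsilon_\infty-1.72|<0.005$. 3. For every $n\ge1$, the Gaussian prior on $\mathbb R^n$ with mean $0$ and covariance matrix $I_n$ satisfies $\bar\gamma=\upsilon_\infty$. -/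

import Mathlib

open MeasureTheory ProbabilityTheory Filter Topology

noncomputable section

namespace IsotropicPrior

/-- A measure on Euclidean space is isotropic if it is invariant under every orthogonal
transformation (linear isometry of `ℝⁿ`, reflections included). -/
def IsIsotropic {n : ℕ} (ν : Measure (EuclideanSpace ℝ (Fin n))) : Prop :=
  ∀ R : EuclideanSpace ℝ (Fin n) ≃ₗᵢ[ℝ] EuclideanSpace ℝ (Fin n), ν.map R = ν

/-- The covariance matrix of a measure on Euclidean space. -/
def covarianceMatrix {n : ℕ} (ν : Measure (EuclideanSpace ℝ (Fin n))) :
    Matrix (Fin n) (Fin n) ℝ :=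
  Matrix.of fun i j => cov[fun x => x i, fun x => x j; ν]

/-- `ν` has a finite second moment and its covariance matrix is the identity. -/
def HasIdentityCovariance {n : ℕ} (ν : Measure (EuclideanSpace ℝ (Fin n))) : Prop :=
  MemLp id 2 ν ∧ covarianceMatrix ν = 1

/-- `𝔼[|x₁|]`, where `x₁` is the first coordinate of `x ∼ ν`. -/
def meanAbsFirst {n : ℕ} [NeZero n] (ν : Measure (EuclideanSpace ℝ (Fin n))) : ℝ :=
  ∫ x, |x 0| ∂ν

/-- `κ = 𝔼[|x₁|] / √(1 + 𝔼[|x₁|]²)`. -/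
def kappa {n : ℕ} [NeZero n] (ν : Measure (EuclideanSpace ℝ (Fin n))) : ℝ :=
  meanAbsFirst ν / √(1 + meanAbsFirst ν ^ 2)

/-- The ratio `γ̄ = 1 + 1 / (1 + κ²)`. -/
def gammaBar {n : ℕ} [NeZero n] (ν : Measure (EuclideanSpace ℝ (Fin n))) : ℝ :=
  1 + 1 / (1 + kappa ν ^ 2)

/-- `υₙ = 3/2 + (1/2) · 1 / (1 + 2 n Γ(n/2)² / (π Γ((n+1)/2)²))`, meaningful for `n ≥ 1`. -/
def upsilon (n : ℕ) : ℝ :=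
  3 / 2 + 1 / 2 * (1 / (1 + 2 * (n : ℝ) * Real.Gamma ((n : ℝ) / 2) ^ 2 /
    (Real.pi * Real.Gamma (((n : ℝ) + 1) / 2) ^ 2)))

/-- The uniform probability distribution on the sphere of radius `√n` centred at the origin of
`ℝⁿ`: the surface measure of the unit sphere, normalized to total mass one and pushed forward
by `u ↦ √n • u`. -/
def uniformSphere (n : ℕ) : Measure (EuclideanSpace ℝ (Fin n)) :=
  let σ : Measure (Metric.sphere (0 : EuclideanSpace ℝ (Fin n)) 1) :=
    (volume : Measure (EuclideanSpace ℝ (Fin n))).toSphere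
  Measure.map (fun u : Metric.sphere (0 : EuclideanSpace ℝ (Fin n)) 1 =>
    √(n : ℝ) • (u : EuclideanSpace ℝ (Fin n))) ((σ Set.univ)⁻¹ • σ)

end IsotropicPrior

end

/-! `gammaBar` is a decreasing function of `m = 𝔼|x₁|` alone. For isotropic `ν`, `m` is `𝔼‖x‖` times
a constant of the dimension, `Γ(n/2) / (√π Γ((n+1)/2))` (`IsIsotropic.meanAbsFirst_mul`). Since
`𝔼‖x‖² = n`, nonnegativity of the variance of `‖x‖` gives `(𝔼‖x‖)² ≤ n`, which is the bound;
equality forces `‖x‖ = √n` a.e., and only one isotropic probability measure lives on that sphere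
(`IsIsotropic.eq_of_ae_norm_eq`). The behaviour of `upsilon` comes from `gammaRatio`, which
decreases to `2`; this uses log-convexity of Gamma and a product identity for consecutive terms. A
standard Gaussian prior has `m = √(2/π)` in every dimension. -/

namespace IsotropicPrior

/-! ### Monotonicity and limit of `upsilon`. -/

/-- `n Γ(n/2)² / Γ((n+1)/2)²`, the quantity that governs `upsilon`. -/
noncomputable def gammaRatio (n : ℕ) : ℝ :=
  n * Real.Gamma ((n : ℝ) / 2) ^ 2 / Real.Gamma (((n : ℝ) + 1) / 2) ^ 2

lemma upsilon_eq (n : ℕ) :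
    upsilon n = 3 / 2 + 1 / 2 * (1 / (1 + 2 / Real.pi * gammaRatio n)) := by
  rw [upsilon, gammaRatio, div_mul_div_comm 2 Real.pi, ← mul_assoc]

lemma gammaRatio_pos {n : ℕ} (hn : 1 ≤ n) : 0 < gammaRatio n := by
  have hn' : (0 : ℝ) < n := by exact_mod_cast hn
  have h1 := Real.Gamma_pos_of_pos (show 0 < (n : ℝ) / 2 by positivity)
  have h2 := Real.Gamma_pos_of_pos (show 0 < ((n : ℝ) + 1) / 2 by positivity)
  unfold gammaRatio
  positivity

/-- The product of consecutive terms has no Gamma factor left. -/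
lemma gammaRatio_mul_succ {n : ℕ} (hn : 1 ≤ n) :
    gammaRatio n * gammaRatio (n + 1) = 4 * (n + 1) / n := by
  have hn' : (0 : ℝ) < n := by exact_mod_cast hn
  have h1 := Real.Gamma_pos_of_pos (show 0 < (n : ℝ) / 2 by positivity)
  have h2 := Real.Gamma_pos_of_pos (show 0 < ((n : ℝ) + 1) / 2 by positivity)
  have h3 : Real.Gamma (((n : ℝ) + 1 + 1) / 2) = n / 2 * Real.Gamma ((n : ℝ) / 2) := by
    rw [← Real.Gamma_add_one (by positivity)]
    congr 1
    ring
  unfold gammaRatio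
  push_cast
  rw [h3]
  field_simp
  norm_num

/-- Log-convexity of Gamma bounds the ratio from below. -/
lemma two_le_gammaRatio {n : ℕ} (hn : 1 ≤ n) : 2 ≤ gammaRatio n := by
  have hn' : (0 : ℝ) < n := by exact_mod_cast hn
  have h1 := Real.Gamma_pos_of_pos (show 0 < (n : ℝ) / 2 by positivity)
  have h2 := Real.Gamma_pos_of_pos (show 0 < ((n : ℝ) + 1) / 2 by positivity)
  -- `(n+1)/2` is the midpoint of `n/2` and `n/2 + 1`.
  have h := Real.Gamma_mul_add_mul_le_rpow_Gamma_mul_rpow_Gamma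
    (s := (n : ℝ) / 2) (t := (n : ℝ) / 2 + 1) (a := 1 / 2) (b := 1 / 2)
    (by positivity) (by positivity) (by norm_num) (by norm_num) (by norm_num)
  rw [Real.Gamma_add_one (by positivity), ← Real.sqrt_eq_rpow, ← Real.sqrt_eq_rpow,
    ← Real.sqrt_mul h1.le, show 1 / 2 * ((n : ℝ) / 2) + 1 / 2 * ((n : ℝ) / 2 + 1)
      = ((n : ℝ) + 1) / 2 by ring] at h
  have h' := (Real.le_sqrt' h2).1 h
  rw [gammaRatio, le_div_iff₀ (by positivity)]
  nlinarith

lemma gammaRatio_succ_le {n : ℕ} (hn : 1 ≤ n) : gammaRatio (n + 1) ≤ 2 * (n + 1) / n := by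
  have hn' : (0 : ℝ) < n := by exact_mod_cast hn
  have h := gammaRatio_mul_succ hn
  have h2 := two_le_gammaRatio hn
  have h3 := gammaRatio_pos (n := n + 1) (by omega)
  have : 2 * gammaRatio (n + 1) ≤ 4 * (n + 1) / n := by nlinarith
  calc gammaRatio (n + 1) ≤ (4 * (n + 1) / n) / 2 := by linarith
    _ = _ := by ring

lemma tendsto_gammaRatio : Tendsto gammaRatio atTop (𝓝 2) := by
  rw [← tendsto_add_atTop_iff_nat 1]
  have hu : Tendsto (fun n : ℕ => (2 : ℝ) + 2 / n) atTop (𝓝 2) := by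
    simpa using (tendsto_const_div_atTop_nhds_zero_nat (2 : ℝ)).const_add 2
  refine tendsto_of_tendsto_of_tendsto_of_le_of_le' tendsto_const_nhds hu
    (.of_forall fun n => two_le_gammaRatio (by omega)) ?_
  filter_upwards [eventually_ge_atTop 1] with n hn
  have hn' : (0 : ℝ) < n := by exact_mod_cast hn
  refine (gammaRatio_succ_le hn).trans_eq ?_
  field_simp

lemma gammaRatio_add_two {n : ℕ} (hn : 1 ≤ n) :
    gammaRatio (n + 2) = n * (n + 2) / (n + 1) ^ 2 * gammaRatio n := by
  have hn' : (0 : ℝ) < n := by exact_mod_cast hn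
  have h0 := gammaRatio_pos (n := n + 1) (by omega)
  have h1 := gammaRatio_mul_succ hn
  have h2 := gammaRatio_mul_succ (n := n + 1) (by omega)
  push_cast at h2
  apply mul_left_cancel₀ h0.ne'
  rw [h2, mul_left_comm, mul_comm (gammaRatio (n + 1)), h1]
  field_simp
  ring

/-- By `gammaRatio_add_two` both terms gain a factor `1 - 1/(k+1)²`, with `k = n` above and `k = n +
1` below; this factor increases with `k`. -/
lemma gammaRatio_quotient_add_two_lt {n : ℕ} (hn : 1 ≤ n) :
    gammaRatio (n + 2) / gammaRatio (n + 3) < gammaRatio n / gammaRatio (n + 1) := by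
  have hn' : (0 : ℝ) < n := by exact_mod_cast hn
  have h0 := gammaRatio_pos hn
  have h1 := gammaRatio_pos (n := n + 1) (by omega)
  rw [gammaRatio_add_two hn, gammaRatio_add_two (n := n + 1) (by omega)]
  push_cast
  rw [div_lt_div_iff₀ (by positivity) h1]
  have key : (n : ℝ) * (n + 2) / (n + 1) ^ 2 < (n + 1) * (n + 1 + 2) / (n + 1 + 1) ^ 2 := by
    rw [div_lt_div_iff₀ (by positivity) (by positivity)]
    nlinarith
  calc _ = (n : ℝ) * (n + 2) / (n + 1) ^ 2 * (gammaRatio n * gammaRatio (n + 1)) := by ring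
    _ < (n + 1) * (n + 1 + 2) / (n + 1 + 1) ^ 2 * (gammaRatio n * gammaRatio (n + 1)) := by gcongr
    _ = _ := by ring

/-- Along indices of one parity the quotients of consecutive terms strictly decrease to `1`, so each
exceeds `1`. -/
lemma gammaRatio_succ_lt {n : ℕ} (hn : 1 ≤ n) : gammaRatio (n + 1) < gammaRatio n := by
  set d : ℕ → ℝ := fun k => gammaRatio (n + 2 * k) / gammaRatio (n + 2 * k + 1) with hd
  have hanti : StrictAnti d :=
    strictAnti_nat_of_succ_lt fun k => gammaRatio_quotient_add_two_lt (n := n + 2 * k) (by omega)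
  have hidx : Tendsto (fun k : ℕ => n + 2 * k) atTop atTop :=
    tendsto_atTop_mono (fun k => by simp only [id]; omega) tendsto_id
  have hlim : Tendsto d atTop (𝓝 1) := by
    have := (tendsto_gammaRatio.comp hidx).div
      (tendsto_gammaRatio.comp ((tendsto_add_atTop_nat 1).comp hidx)) two_ne_zero
    simpa using! this
  have h1 : 1 < d 0 := (hanti.antitone.le_of_tendsto hlim 1).trans_lt (hanti zero_lt_one)
  simpa [hd, one_lt_div (gammaRatio_pos (n := n + 1) (by omega))] using h1

lemma strictMonoOn_upsilon : StrictMonoOn upsilon (Set.Ici 1) := by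
  refine strictMonoOn_of_lt_add_one Set.ordConnected_Ici fun n _ hn _ => ?_
  have hn : 1 ≤ n := hn
  have h := gammaRatio_succ_lt hn
  have h0 := gammaRatio_pos (n := n + 1) (by omega)
  rw [upsilon_eq, upsilon_eq]
  gcongr

lemma tendsto_upsilon :
    Tendsto upsilon atTop (𝓝 (2 * (3 + Real.pi) / (4 + Real.pi))) := by
  have hpi := Real.pi_pos
  have h : Tendsto (fun n => 3 / 2 + 1 / 2 * (1 / (1 + 2 / Real.pi * gammaRatio n))) atTop
      (𝓝 (3 / 2 + 1 / 2 * (1 / (1 + 2 / Real.pi * 2)))) :=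
    ((tendsto_const_nhds.div ((tendsto_gammaRatio.const_mul _).const_add 1)
      (by positivity)).const_mul _).const_add _
  rw [funext upsilon_eq]
  convert h using 2
  field_simp
  ring

lemma abs_limit_sub_lt : |2 * (3 + Real.pi) / (4 + Real.pi) - 1.72| < 0.005 := by
  have h1 := Real.pi_gt_d2
  have h2 := Real.pi_lt_d2
  rw [abs_lt, lt_sub_iff_add_lt, sub_lt_iff_lt_add, lt_div_iff₀ (by linarith),
    div_lt_iff₀ (by linarith)]
  constructor <;> linarith

/-! ### Isotropic measures. -/

section Isotropic

variable {n : ℕ} {ν : Measure (EuclideanSpace ℝ (Fin n))}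

lemma exists_linearIsometryEquiv_apply_eq {E : Type*} [NormedAddCommGroup E]
    [InnerProductSpace ℝ E] {x y : E} (h : ‖x‖ = ‖y‖) : ∃ R : E ≃ₗᵢ[ℝ] E, R x = y :=
  ⟨(ℝ ∙ (x - y))ᗮ.reflection, Submodule.reflection_sub h⟩

lemma isIsotropic_volume : IsIsotropic (volume : Measure (EuclideanSpace ℝ (Fin n))) :=
  fun R => R.measurePreserving.map_eq

lemma IsIsotropic.integral_comp {F : Type*} [NormedAddCommGroup F] [NormedSpace ℝ F]
    (hν : IsIsotropic ν) (R : EuclideanSpace ℝ (Fin n) ≃ₗᵢ[ℝ] EuclideanSpace ℝ (Fin n))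
    (f : EuclideanSpace ℝ (Fin n) → F) : ∫ x, f (R x) ∂ν = ∫ x, f x ∂ν :=
  MeasurePreserving.integral_comp ⟨R.continuous.measurable, hν R⟩
    R.toHomeomorph.measurableEmbedding f

/-- An isometry carries `‖x‖ e₁` to `x`. The radial weight lets the lemma serve both `ν` (weight
`1`) and Lebesgue measure (Gaussian weight). -/
lemma IsIsotropic.integral_abs_inner_mul [NeZero n] (hν : IsIsotropic ν) (w : ℝ → ℝ)
    (x : EuclideanSpace ℝ (Fin n)) :
    ∫ y, |inner ℝ x y| * w ‖y‖ ∂ν = ‖x‖ * ∫ y, |y 0| * w ‖y‖ ∂ν := by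
  obtain ⟨R, hR⟩ := exists_linearIsometryEquiv_apply_eq
    (x := ‖x‖ • EuclideanSpace.single (0 : Fin n) (1 : ℝ)) (y := x) (by simp [norm_smul])
  rw [← hν.integral_comp R, ← integral_const_mul]
  congr 1 with y
  nth_rw 1 [← hR]
  rw [R.inner_map_map, R.norm_map, real_inner_smul_left, EuclideanSpace.inner_single_left,
    abs_mul, abs_norm]
  simp [mul_assoc]

lemma IsIsotropic.charFun_eq (hν : IsIsotropic ν) {s t : EuclideanSpace ℝ (Fin n)}
    (h : ‖s‖ = ‖t‖) : charFun ν s = charFun ν t := by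
  obtain ⟨R, rfl⟩ := exists_linearIsometryEquiv_apply_eq h
  rw [charFun_apply, charFun_apply]
  conv_rhs => rw [← hν.integral_comp R]
  simp only [R.inner_map_map]

/-- Two isotropic probability measures carried by the same centred sphere coincide. -/
lemma IsIsotropic.eq_of_ae_norm_eq [NeZero n] {μ : Measure (EuclideanSpace ℝ (Fin n))}
    [IsProbabilityMeasure μ] [IsProbabilityMeasure ν] (hμ : IsIsotropic μ) (hν : IsIsotropic ν)
    {r : ℝ} (hr : 0 < r) (hμr : ∀ᵐ x ∂μ, ‖x‖ = r) (hνr : ∀ᵐ x ∂ν, ‖x‖ = r) : μ = ν := by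
  -- The scaled vector has norm `‖t‖` for almost every `x`, so the inner integral is constant. The
  -- kernel is symmetric in `x` and `y`, so Fubini then identifies the two characteristic functions.
  have key : ∀ {μ ν : Measure (EuclideanSpace ℝ (Fin n))} [IsProbabilityMeasure μ]
      [IsProbabilityMeasure ν], IsIsotropic ν → (∀ᵐ x ∂μ, ‖x‖ = r) →
      ∀ t : EuclideanSpace ℝ (Fin n),
        ∫ x, ∫ y, Complex.exp ((inner ℝ y ((‖t‖ / r) • x) : ℝ) * Complex.I) ∂ν ∂μ =
          charFun ν t := by
    intro μ ν _ _ hν hμr t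
    have h : (fun x => ∫ y, Complex.exp ((inner ℝ y ((‖t‖ / r) • x) : ℝ) * Complex.I) ∂ν)
        =ᵐ[μ] fun _ => charFun ν t := by
      filter_upwards [hμr] with x hx
      rw [← charFun_apply]
      apply hν.charFun_eq
      rw [norm_smul, hx, Real.norm_of_nonneg (by positivity)]
      field_simp
    rw [integral_congr_ae h]
    simp
  refine Measure.ext_of_charFun (funext fun t => ?_)
  rw [← key hμ hνr t, ← key hν hμr t, integral_integral_swap]
  · simp only [real_inner_smul_right, real_inner_comm]
  · refine Integrable.of_bound (C := 1) (by fun_prop) (.of_forall fun p => ?_)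
    simp [Function.uncurry, Complex.norm_exp_ofReal_mul_I]

end Isotropic

/-! ### The uniform distribution on the sphere. -/

section UniformSphere

variable {n : ℕ}

lemma toSphere_map_isometry (R : EuclideanSpace ℝ (Fin n) ≃ₗᵢ[ℝ] EuclideanSpace ℝ (Fin n))
    (s : Set (EuclideanSpace ℝ (Fin n))) (hs : MeasurableSet s) :
    (volume : Measure (EuclideanSpace ℝ (Fin n))).toSphere
        ((fun u : Metric.sphere (0 : EuclideanSpace ℝ (Fin n)) 1 => R u) ⁻¹' s) =
      (volume : Measure (EuclideanSpace ℝ (Fin n))).toSphere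
        ((fun u : Metric.sphere (0 : EuclideanSpace ℝ (Fin n)) 1 =>
          (u : EuclideanSpace ℝ (Fin n))) ⁻¹' s) := by
  have hm : Measurable fun u : Metric.sphere (0 : EuclideanSpace ℝ (Fin n)) 1 => R u :=
    R.continuous.measurable.comp measurable_subtype_coe
  rw [Measure.toSphere_apply' _ (hm hs), Measure.toSphere_apply' _ (measurable_subtype_coe hs)]
  congr 1
  -- `toSphere` measures a set by the volume of the cone over it, and taking cones commutes with
  -- `R`.
  refine Eq.trans (congrArg _ ?_)
    (R.measurePreserving.measure_preimage_emb R.toHomeomorph.measurableEmbedding _)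
  ext x
  simp only [Set.mem_smul, Set.mem_image, Set.mem_preimage, Subtype.exists]
  constructor
  · rintro ⟨c, hc, _, ⟨u, hu, hus, rfl⟩, rfl⟩
    exact ⟨c, hc, _, ⟨R u, by simpa using hu, hus, rfl⟩, by simp⟩
  · rintro ⟨c, hc, _, ⟨u, hu, hus, rfl⟩, h⟩
    refine ⟨c, hc, _, ⟨R.symm u, by simpa using hu, by simpa using hus, rfl⟩, ?_⟩
    apply R.injective
    simpa using h

instance isProbabilityMeasure_uniformSphere [NeZero n] :
    IsProbabilityMeasure (uniformSphere n) := by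
  have hne : (volume : Measure (EuclideanSpace ℝ (Fin n))).toSphere ≠ 0 := by simp
  have : NeZero (volume : Measure (EuclideanSpace ℝ (Fin n))).toSphere := ⟨hne⟩
  exact Measure.isProbabilityMeasure_map (by fun_prop)

lemma ae_norm_uniformSphere : ∀ᵐ x ∂uniformSphere n, ‖x‖ = √(n : ℝ) := by
  rw [uniformSphere, ae_map_iff (by fun_prop)
    (measurableSet_eq_fun measurable_norm measurable_const)]
  refine .of_forall fun u => ?_
  simp [norm_smul]

lemma isIsotropic_uniformSphere : IsIsotropic (uniformSphere n) := by
  intro R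
  ext s hs
  have hc : Measurable fun x : EuclideanSpace ℝ (Fin n) => √(n : ℝ) • x := by fun_prop
  have hR : Measurable R := R.continuous.measurable
  rw [Measure.map_apply hR hs]
  simp only [uniformSphere]
  rw [Measure.map_apply (by fun_prop) (hR hs), Measure.map_apply (by fun_prop) hs]
  simp only [Measure.smul_apply]
  congr 1
  have := toSphere_map_isometry R _ (hc hs)
  simpa [Set.preimage_preimage, ← Set.preimage_comp, Function.comp_def] using this

end UniformSphere

/-! ### Gaussian integrals in one and `n` dimensions. -/

lemma integral_abs_mul_exp_neg_mul_sq {b : ℝ} (hb : 0 < b) :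
    ∫ t : ℝ, |t| * Real.exp (-b * t ^ 2) = b⁻¹ := by
  have h := integral_comp_abs (f := fun t : ℝ => t * Real.exp (-b * t ^ 2))
  have h2 := integral_rpow_mul_exp_neg_mul_rpow (p := 2) (q := 1) two_pos (by norm_num) hb
  simp only [Real.rpow_one, Real.rpow_ofNat, sq_abs] at h h2
  rw [h, h2]
  norm_num [Real.rpow_neg_one]
  ring

lemma integral_abs_gaussianReal_zero_one :
    ∫ t, |t| ∂gaussianReal 0 1 = √(2 / Real.pi) := by
  rw [integral_gaussianReal_eq_integral_smul one_ne_zero]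
  have h : ∀ t : ℝ, gaussianPDFReal 0 1 t • |t| =
      (√(2 * Real.pi))⁻¹ * (|t| * Real.exp (-(1 / 2) * t ^ 2)) := by
    intro t
    simp only [gaussianPDFReal, smul_eq_mul, NNReal.coe_one, mul_one, sub_zero]
    ring_nf
  simp_rw [h]
  rw [integral_const_mul, integral_abs_mul_exp_neg_mul_sq (by norm_num)]
  rw [eq_comm, Real.sqrt_eq_iff_mul_self_eq (by positivity) (by positivity)]
  have h2 := Real.mul_self_sqrt (show 0 ≤ 2 * Real.pi by positivity)
  have hpi := Real.pi_pos
  have h3 : 0 < √(2 * Real.pi) := by positivity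
  field_simp
  nlinarith

variable {n : ℕ}

lemma integral_euclideanSpace_prod (f : Fin n → ℝ → ℝ) :
    ∫ y : EuclideanSpace ℝ (Fin n), ∏ i, f i (y i) = ∏ i, ∫ t, f i t := by
  rw [← integral_fintype_prod_volume_eq_prod]
  exact (EuclideanSpace.volume_preserving_symm_measurableEquiv_toLp (Fin n)).integral_comp
    (MeasurableEquiv.measurableEmbedding _) (fun y : Fin n → ℝ => ∏ i, f i (y i))

lemma exp_neg_norm_sq (y : EuclideanSpace ℝ (Fin n)) :
    Real.exp (-‖y‖ ^ 2) = ∏ i, Real.exp (-1 * y i ^ 2) := by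
  rw [EuclideanSpace.real_norm_sq_eq, ← Real.exp_sum, ← Finset.sum_neg_distrib]
  simp

lemma integral_exp_neg_norm_sq :
    ∫ y : EuclideanSpace ℝ (Fin n), Real.exp (-‖y‖ ^ 2) = √Real.pi ^ n := by
  simp_rw [exp_neg_norm_sq]
  rw [integral_euclideanSpace_prod fun _ t => Real.exp (-1 * t ^ 2)]
  simp_rw [integral_gaussian]
  simp

/-- The integral factors over coordinates; coordinate `i` contributes `1` and each other one `√π`.
-/
lemma integral_abs_apply_mul_exp_neg_norm_sq (i : Fin n) :
    ∫ y : EuclideanSpace ℝ (Fin n), |y i| * Real.exp (-‖y‖ ^ 2) =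
      √Real.pi ^ n * (√Real.pi)⁻¹ := by
  have h : ∀ y : EuclideanSpace ℝ (Fin n), |y i| * Real.exp (-‖y‖ ^ 2) =
      ∏ j, (if j = i then |y j| else 1) * Real.exp (-1 * y j ^ 2) := by
    intro y
    rw [exp_neg_norm_sq, Finset.prod_mul_distrib]
    simp
  simp_rw [h]
  rw [integral_euclideanSpace_prod fun j t => (if j = i then |t| else 1) * Real.exp (-1 * t ^ 2)]
  have h' : ∀ j : Fin n, ∫ t : ℝ, (if j = i then |t| else 1) * Real.exp (-1 * t ^ 2) =
      √Real.pi * (if j = i then (√Real.pi)⁻¹ else 1) := by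
    intro j
    have hpi := Real.pi_pos
    split_ifs
    · rw [integral_abs_mul_exp_neg_mul_sq one_pos, mul_inv_cancel₀ (by positivity), inv_one]
    · simp only [one_mul, integral_gaussian]
      simp
  simp_rw [h']
  rw [Finset.prod_mul_distrib]
  simp

/-- In polar coordinates this integral and the total Gaussian mass share the same surface-area
factor, which cancels without being computed. -/
lemma integral_norm_mul_exp_neg_norm_sq [NeZero n] :
    (∫ y : EuclideanSpace ℝ (Fin n), ‖y‖ * Real.exp (-‖y‖ ^ 2)) * Real.Gamma ((n : ℝ) / 2) =
      √Real.pi ^ n * Real.Gamma (((n : ℝ) + 1) / 2) := by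
  have hn : 1 ≤ n := NeZero.one_le
  have h0 : ∫ r in Set.Ioi (0 : ℝ), r ^ (n - 1) • Real.exp (-r ^ 2) =
      1 / 2 * Real.Gamma ((n : ℝ) / 2) := by
    have h := integral_rpow_mul_exp_neg_rpow (p := 2) (q := ((n - 1 : ℕ) : ℝ)) two_pos
      (by linarith [Nat.cast_nonneg (α := ℝ) (n - 1)])
    simp only [Real.rpow_natCast, Real.rpow_ofNat] at h
    simpa [Nat.cast_sub hn] using h
  have h1 : ∫ r in Set.Ioi (0 : ℝ), r ^ (n - 1) • (r * Real.exp (-r ^ 2)) =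
      1 / 2 * Real.Gamma (((n : ℝ) + 1) / 2) := by
    have h := integral_rpow_mul_exp_neg_rpow (p := 2) (q := (n : ℝ)) two_pos
      (by linarith [Nat.cast_nonneg (α := ℝ) n])
    simp only [Real.rpow_natCast, Real.rpow_ofNat] at h
    rw [← h]
    congr 1 with r
    rw [smul_eq_mul, ← mul_assoc, ← pow_succ, Nat.sub_add_cancel hn]
  have e0 := integral_fun_norm_addHaar (volume : Measure (EuclideanSpace ℝ (Fin n)))
    fun r => Real.exp (-r ^ 2)
  have e1 := integral_fun_norm_addHaar (volume : Measure (EuclideanSpace ℝ (Fin n)))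
    fun r => r * Real.exp (-r ^ 2)
  rw [finrank_euclideanSpace_fin, h0, integral_exp_neg_norm_sq] at e0
  rw [finrank_euclideanSpace_fin, h1] at e1
  rw [e0, e1]
  simp only [nsmul_eq_mul, smul_eq_mul]
  ring

lemma integrable_norm_mul_exp_neg_norm_sq :
    Integrable fun y : EuclideanSpace ℝ (Fin n) => ‖y‖ * Real.exp (-‖y‖ ^ 2) := by
  rcases n.eq_zero_or_pos with rfl | hn
  · simp [Subsingleton.elim _ (0 : EuclideanSpace ℝ (Fin 0))]
  have : NeZero n := ⟨hn.ne'⟩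
  refine (integrable_fun_norm_addHaar (f := fun r => r * Real.exp (-r ^ 2)) volume).2 ?_
  have h := integrableOn_rpow_mul_exp_neg_rpow (p := 2) (s := (n : ℝ))
    (by linarith [Nat.cast_nonneg (α := ℝ) n]) two_pos
  simp only [Real.rpow_natCast, Real.rpow_ofNat] at h
  convert h using 2 with r
  rw [finrank_euclideanSpace_fin, smul_eq_mul, ← mul_assoc, ← pow_succ, Nat.sub_add_cancel hn]

/-! ### The ratio of an isotropic prior in terms of its mean norm. -/

/-- Integrate `|⟨x, y⟩| exp (-‖y‖²)` over `x ∼ ν` and Lebesgue `y` in both orders. -/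
lemma IsIsotropic.meanAbsFirst_mul [NeZero n] {ν : Measure (EuclideanSpace ℝ (Fin n))}
    [IsProbabilityMeasure ν] (hν : IsIsotropic ν) (hint : Integrable (fun x => ‖x‖) ν) :
    meanAbsFirst ν * (√Real.pi * Real.Gamma (((n : ℝ) + 1) / 2)) =
      (∫ x, ‖x‖ ∂ν) * Real.Gamma ((n : ℝ) / 2) := by
  have hdom := hint.mul_prod (integrable_norm_mul_exp_neg_norm_sq (n := n))
  have hprod : Integrable (Function.uncurry fun x y : EuclideanSpace ℝ (Fin n) =>
      |inner ℝ x y| * Real.exp (-‖y‖ ^ 2)) (ν.prod volume) := by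
    refine hdom.mono' (by fun_prop) (.of_forall fun p => ?_)
    simp only [Function.uncurry, norm_mul, Real.norm_eq_abs, abs_abs, Real.abs_exp, ← mul_assoc]
    gcongr
    exact abs_real_inner_le_norm _ _
  have hswap := integral_integral_swap hprod
  -- `hl` uses the isotropy of Lebesgue measure, `hr` that of `ν`.
  have hl : ∀ x : EuclideanSpace ℝ (Fin n), ∫ y, |inner ℝ x y| * Real.exp (-‖y‖ ^ 2) =
      ‖x‖ * (√Real.pi ^ n * (√Real.pi)⁻¹) := fun x => by
    rw [isIsotropic_volume.integral_abs_inner_mul (fun r => Real.exp (-r ^ 2)),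
      integral_abs_apply_mul_exp_neg_norm_sq]
  have hr : ∀ y : EuclideanSpace ℝ (Fin n), ∫ x, |inner ℝ x y| * Real.exp (-‖y‖ ^ 2) ∂ν =
      meanAbsFirst ν * (‖y‖ * Real.exp (-‖y‖ ^ 2)) := fun y => by
    have h := hν.integral_abs_inner_mul (fun _ => 1) y
    simp only [mul_one] at h
    rw [integral_mul_const]
    simp_rw [real_inner_comm y]
    rw [h, meanAbsFirst]
    ring
  simp_rw [hl, hr] at hswap
  rw [integral_mul_const, integral_const_mul] at hswap
  have hpi : 0 < √Real.pi := Real.sqrt_pos.2 Real.pi_pos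
  have h1 := integral_norm_mul_exp_neg_norm_sq (n := n)
  apply mul_left_cancel₀ (pow_pos hpi n).ne'
  calc _ = meanAbsFirst ν * √Real.pi * (√Real.pi ^ n * Real.Gamma (((n : ℝ) + 1) / 2)) := by ring
    _ = (meanAbsFirst ν * ∫ y : EuclideanSpace ℝ (Fin n), ‖y‖ * Real.exp (-‖y‖ ^ 2)) *
        √Real.pi * Real.Gamma ((n : ℝ) / 2) := by rw [← h1]; ring
    _ = _ := by
      rw [← hswap]
      field_simp

lemma gammaBar_eq [NeZero n] (ν : Measure (EuclideanSpace ℝ (Fin n))) :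
    gammaBar ν = 3 / 2 + 1 / 2 * (1 / (1 + 2 * meanAbsFirst ν ^ 2)) := by
  rw [gammaBar, kappa, div_pow, Real.sq_sqrt (by positivity)]
  field_simp
  ring

lemma IsIsotropic.gammaBar_eq [NeZero n] {ν : Measure (EuclideanSpace ℝ (Fin n))}
    [IsProbabilityMeasure ν] (hν : IsIsotropic ν) (hint : Integrable (fun x => ‖x‖) ν) :
    gammaBar ν = 3 / 2 + 1 / 2 * (1 / (1 + 2 * (∫ x, ‖x‖ ∂ν) ^ 2 * Real.Gamma ((n : ℝ) / 2) ^ 2 /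
      (Real.pi * Real.Gamma (((n : ℝ) + 1) / 2) ^ 2))) := by
  have hG := Real.Gamma_pos_of_pos (show 0 < ((n : ℝ) + 1) / 2 by positivity)
  have hpi := Real.pi_pos
  have h : meanAbsFirst ν ^ 2 = (∫ x, ‖x‖ ∂ν) ^ 2 * Real.Gamma ((n : ℝ) / 2) ^ 2 /
      (Real.pi * Real.Gamma (((n : ℝ) + 1) / 2) ^ 2) := by
    rw [eq_div_iff (by positivity), ← mul_pow, ← hν.meanAbsFirst_mul hint, mul_pow, mul_pow,
      Real.sq_sqrt hpi.le]
  rw [IsotropicPrior.gammaBar_eq, h, mul_assoc 2, mul_div_assoc 2]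

/-! ### Second moments, the lower bound and its equality case. -/

lemma HasIdentityCovariance.memLp_apply {ν : Measure (EuclideanSpace ℝ (Fin n))}
    (h : HasIdentityCovariance ν) (i : Fin n) : MemLp (fun x => x i) 2 ν :=
  h.1.continuousLinearMap_comp (EuclideanSpace.proj i : EuclideanSpace ℝ (Fin n) →L[ℝ] ℝ)

lemma HasIdentityCovariance.variance_apply {ν : Measure (EuclideanSpace ℝ (Fin n))}
    (h : HasIdentityCovariance ν) (i : Fin n) : Var[fun x => x i; ν] = 1 := by
  rw [← covariance_self (h.memLp_apply i).aemeasurable]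
  simpa [covarianceMatrix] using congrFun (congrFun h.2 i) i

/-- Invariance under `x ↦ -x` suffices. -/
lemma IsIsotropic.integral_apply {ν : Measure (EuclideanSpace ℝ (Fin n))} (hν : IsIsotropic ν)
    (i : Fin n) : ∫ x, x i ∂ν = 0 := by
  have h := hν.integral_comp (LinearIsometryEquiv.neg ℝ) fun x => x i
  simp only [LinearIsometryEquiv.coe_neg, PiLp.neg_apply, integral_neg] at h
  linarith

lemma IsIsotropic.integral_norm_sq {ν : Measure (EuclideanSpace ℝ (Fin n))}
    [IsProbabilityMeasure ν] (hν : IsIsotropic ν) (h : HasIdentityCovariance ν) :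
    ∫ x, ‖x‖ ^ 2 ∂ν = n := by
  simp_rw [EuclideanSpace.real_norm_sq_eq]
  rw [integral_finsetSum _ fun i _ => (h.memLp_apply i).integrable_sq]
  have h1 : ∀ i, ∫ x, x i ^ 2 ∂ν = 1 := fun i => by
    have := variance_eq_sub (h.memLp_apply i)
    rw [h.variance_apply, hν.integral_apply] at this
    simpa using this.symm
  simp [h1]

/-- The mean norm is at most `√n`, with equality only on the sphere of radius `√n`. -/
lemma IsIsotropic.integral_norm_le {ν : Measure (EuclideanSpace ℝ (Fin n))}
    [IsProbabilityMeasure ν] (hν : IsIsotropic ν) (h : HasIdentityCovariance ν) :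
    (∫ x, ‖x‖ ∂ν) ^ 2 ≤ n ∧ ((∫ x, ‖x‖ ∂ν) ^ 2 = n → ∀ᵐ x ∂ν, ‖x‖ = √(n : ℝ)) := by
  have hL : MemLp (fun x => ‖x‖) 2 ν := h.1.norm
  have hv : Var[fun x => ‖x‖; ν] = n - (∫ x, ‖x‖ ∂ν) ^ 2 := by
    rw [variance_eq_sub hL, ← hν.integral_norm_sq h]
    rfl
  refine ⟨by linarith [variance_nonneg (fun x => ‖x‖) ν], fun he => ?_⟩
  rw [he, sub_self] at hv
  have hm : ∫ x, ‖x‖ ∂ν = √(n : ℝ) := by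
    rw [← he, Real.sqrt_sq (integral_nonneg fun _ => norm_nonneg _)]
  rw [← hm]
  exact ae_eq_integral_of_variance_eq_zero hL hv

lemma IsIsotropic.upsilon_le_gammaBar [NeZero n] {ν : Measure (EuclideanSpace ℝ (Fin n))}
    [IsProbabilityMeasure ν] (hν : IsIsotropic ν) (h : HasIdentityCovariance ν) :
    upsilon n ≤ gammaBar ν ∧ (gammaBar ν = upsilon n ↔ ν = uniformSphere n) := by
  have hL : MemLp (fun x => ‖x‖) 2 ν := h.1.norm
  have hint : Integrable (fun x => ‖x‖) ν := hL.integrable one_le_two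
  have hn : (0 : ℝ) < n := by exact_mod_cast NeZero.pos n
  have hG := Real.Gamma_pos_of_pos (show 0 < ((n : ℝ) + 1) / 2 by positivity)
  have hG' := Real.Gamma_pos_of_pos (show 0 < (n : ℝ) / 2 by positivity)
  have hpi := Real.pi_pos
  obtain ⟨hle, heq⟩ := hν.integral_norm_le h
  refine ⟨?_, fun he => ?_, fun he => ?_⟩
  · rw [hν.gammaBar_eq hint, upsilon]
    gcongr
  · refine hν.eq_of_ae_norm_eq isIsotropic_uniformSphere (Real.sqrt_pos.2 hn) (heq ?_)
      ae_norm_uniformSphere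
    -- A strict inequality for the mean norm would make the bound strict.
    by_contra hne
    refine he.not_gt ?_
    have hlt := lt_of_le_of_ne hle hne
    rw [hν.gammaBar_eq hint, upsilon]
    gcongr
  · have hE : ∫ x, ‖x‖ ∂ν = √(n : ℝ) := by
      have hs : ∀ᵐ x ∂ν, ‖x‖ = √(n : ℝ) := he ▸ ae_norm_uniformSphere
      rw [integral_congr_ae hs]
      simp
    rw [hν.gammaBar_eq hint, hE, Real.sq_sqrt hn.le, upsilon]

/-! ### Gaussian priors. -/

lemma gammaBar_of_isGaussian [NeZero n] {ν : Measure (EuclideanSpace ℝ (Fin n))} [IsGaussian ν]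
    (h0 : ∫ x, x ∂ν = 0) (h : HasIdentityCovariance ν) :
    gammaBar ν = 2 * (3 + Real.pi) / (4 + Real.pi) := by
  set L : EuclideanSpace ℝ (Fin n) →L[ℝ] ℝ := EuclideanSpace.proj 0 with hL
  -- Only the first marginal matters, hence the independence from `n`.
  have hmap : ν.map L = gaussianReal 0 1 := by
    have hm : ∫ x, L x ∂ν = 0 := by
      rw [L.integral_comp_comm (φ := fun x => x) IsGaussian.integrable_id, h0, map_zero]
    have hv : Var[L; ν] = 1 := h.variance_apply 0
    rw [IsGaussian.map_eq_gaussianReal, hm, hv, Real.toNNReal_one]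
  have hmean : meanAbsFirst ν = √(2 / Real.pi) := by
    rw [← integral_abs_gaussianReal_zero_one, ← hmap, integral_map (by fun_prop) (by fun_prop)]
    rfl
  have hpi := Real.pi_pos
  rw [gammaBar_eq, hmean, Real.sq_sqrt (by positivity)]
  field_simp
  ring

end IsotropicPrior

theorem mainTheorem12 :
    -- lower bound for isotropic priors of identity covariance, with its case of equality
    (∀ (n : ℕ) [NeZero n] (ν : Measure (EuclideanSpace ℝ (Fin n))) [IsProbabilityMeasure ν],
      IsotropicPrior.IsIsotropic ν → IsotropicPrior.HasIdentityCovariance ν →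
        IsotropicPrior.upsilon n ≤ IsotropicPrior.gammaBar ν ∧
        (IsotropicPrior.gammaBar ν = IsotropicPrior.upsilon n ↔
          ν = IsotropicPrior.uniformSphere n)) ∧
    -- the sequence increases over n = 1, 2, 3, ...
    StrictMonoOn IsotropicPrior.upsilon (Set.Ici 1) ∧
    -- its limit, and the numerical value of the limit rounded to two decimals
    Tendsto IsotropicPrior.upsilon atTop (𝓝 (2 * (3 + Real.pi) / (4 + Real.pi))) ∧
    |2 * (3 + Real.pi) / (4 + Real.pi) - 1.72| < 0.005 ∧
    -- the limit is the ratio for (centred, reduced) Gaussian priors, in every dimension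
    (∀ (n : ℕ) [NeZero n] (ν : Measure (EuclideanSpace ℝ (Fin n))) [IsGaussian ν],
      ∫ x, x ∂ν = 0 → IsotropicPrior.HasIdentityCovariance ν →
        IsotropicPrior.gammaBar ν = 2 * (3 + Real.pi) / (4 + Real.pi)) := by
  exact ⟨fun _ _ _ _ hν h => hν.upsilon_le_gammaBar h, IsotropicPrior.strictMonoOn_upsilon,
    IsotropicPrior.tendsto_upsilon, IsotropicPrior.abs_limit_sub_lt,
    fun _ _ _ _ h0 h => IsotropicPrior.gammaBar_of_isGaussian h0 h⟩
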